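/- For $r,t>0$ let $$F_t(r)=\frac{e^{\pi^2/(2t)}}{\sqrt{2\pi^3t}}\int_0^\infty e^{-y^2/(2t)}\,e^{-r\cosh y}\,\sinh y\,\sin\frac{\pi y}{t}\,dy$$ be the Yor integral. Let $K_{i\tau}(x)=\int_0^\infty e^{-x\cosh u}\cos(\tau u)\,du$ $(x>0)$ be the modified Bessel function of imaginary index, let $$p_k(x)=(-1)^k e^{x}\mathcal A^k e^{-x},\qquad \mathcal A=x^2-x\frac{d}{dx}\,x\frac{d}{dx},$$ let $$(f*g)(x)=\frac1{2x}\int_0^\infty\!\!\int_0^\infty \exp\Big(-\tfrac12\Big(x\,\frac{u^2+y^2}{uy}+\frac{uy}{x}\Big)\Big)f(u)\,g(y)\,du\,dy\qquad(x>0)$$ be the Kontorovich–Lebedev convolution, and let $$h_t(x,y)=\frac{2}{x\pi^2}\int_0^\infty e^{-t\tau^2/2}\,\tau\sinh(\pi\tau)\,K_{i\tau}(x)K_{i\tau}(y)\,d\tau\qquad(x,y>0)$$ be the heat kernel of the Kontorovich–Lebedev transform. Let $r,t>0$, and write $w_k(u)=e^{-u}p_k(u)/u$. For every $k\ge1$ the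 integrals defining $(w_k*F_t)(r)$ and $$a_k(r,t)=\int_0^\infty e^{-u}\,h_t(r,u)\,p_k(u)\,\frac{du}{u}$$ converge absolutely, and, with both series converging absolutely, $$F_t(r)=\sum_{k=1}^\infty\frac{(-1)^k\pi^{2(k-1)}}{(2k-1)!}\,(w_k*F_t)(r),\qquad 2F_t(r)=\sum_{k=1}^\infty\frac{(-1)^k\pi^{2(k-1)}}{(2k-1)!}\,a_k(r,t).$$ -/

import Mathlib

open Real MeasureTheory Set

noncomputable section

/-- The Yor integral `F_t(r)`, for `r, t > 0`. -/
def yorF (t r : ℝ) : ℝ :=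
  exp (π ^ 2 / (2 * t)) / √(2 * π ^ 3 * t) *
    ∫ y in Ioi (0 : ℝ),
      exp (-(y ^ 2 / (2 * t))) * exp (-(r * cosh y)) * sinh y * sin (π * y / t)

/-- The modified Bessel function `K_{iτ}(x)` of purely imaginary index, for `x > 0`: the integral
`K_ν(x) = ∫_0^∞ exp(-x cosh u) cosh(ν u) du` at `ν = iτ`, where `cosh(iτu) = cos(τu)`. -/
def besselKi (τ x : ℝ) : ℝ :=
  ∫ u in Ioi (0 : ℝ), exp (-(x * cosh u)) * cos (τ * u)

/-- The operator `x² - x (d/dx) x (d/dx)`. -/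
def klOp (f : ℝ → ℝ) (x : ℝ) : ℝ :=
  x ^ 2 * f x - x * deriv (fun y : ℝ => y * deriv f y) x

/-- `p_n(x) = (-1)^n e^x A^n e^{-x}`, with `A^n` the `n`-th iterate of `klOp`. -/
def klPoly (n : ℕ) (x : ℝ) : ℝ :=
  (-1) ^ n * exp x * (klOp^[n] (fun y : ℝ => exp (-y))) x

/-- The integrand of the Kontorovich-Lebedev convolution of `f` and `g` at `x`, as a function of
`z = (u, y)`. -/
def klConvIntegrand (f g : ℝ → ℝ) (x : ℝ) (z : ℝ × ℝ) : ℝ :=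
  exp (-(1 / 2) * (x * ((z.1 ^ 2 + z.2 ^ 2) / (z.1 * z.2)) + z.2 * z.1 / x)) * f z.1 * g z.2

/-- The Kontorovich-Lebedev convolution `(f * g)(x)`, for `x > 0`. -/
def klConv (f g : ℝ → ℝ) (x : ℝ) : ℝ :=
  1 / (2 * x) * ∫ z in Ioi (0 : ℝ) ×ˢ Ioi (0 : ℝ), klConvIntegrand f g x z

/-- The heat kernel `h_t(x, y)` of the Kontorovich-Lebedev transform, for `t, x, y > 0`. -/
def klHeat (t x y : ℝ) : ℝ :=
  2 / (x * π ^ 2) * ∫ τ in Ioi (0 : ℝ),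
    exp (-(t * τ ^ 2 / 2)) * τ * sinh (π * τ) * besselKi τ x * besselKi τ y

/-- The function `u ↦ e^{-u} p_k(u) / u`. -/
def klWeight (k : ℕ) (u : ℝ) : ℝ :=
  exp (-u) * klPoly k u / u

/-- The coefficient `a_k(r, t) = ∫_0^∞ e^{-u} h_t(r, u) p_k(u) du / u`. -/
def yorCoeff (k : ℕ) (r t : ℝ) : ℝ :=
  ∫ u in Ioi (0 : ℝ), exp (-u) * klHeat t r u * klPoly k u / u

end

/-- The action of `-klOp` on the cofactor `Q` of a function `x ↦ x Q(x) e^{-x}`. -/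
noncomputable def klStep (Q : Polynomial ℝ) : Polynomial ℝ :=
  Polynomial.X ^ 2 * Q.derivative.derivative + 3 * (Polynomial.X * Q.derivative) + Q
    - 3 * (Polynomial.X * Q) - 2 * (Polynomial.X ^ 2 * Q.derivative)

/-- The polynomial `p_{k+1}(x) / x`. -/
noncomputable def klCofactor (k : ℕ) : Polynomial ℝ := klStep^[k] (-1)

theorem klOp_exp_neg : klOp (fun y : ℝ => exp (-y)) = fun y => y * exp (-y) := by
  have h1 : (fun y : ℝ => y * deriv (fun y : ℝ => exp (-y)) y) = fun y => -(y * exp (-y)) := by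
    funext y
    have : HasDerivAt (fun y : ℝ => exp (-y)) (exp (-y) * (-1)) y :=
      (hasDerivAt_neg y).exp
    rw [this.deriv]; ring
  funext x
  have h2 : HasDerivAt (fun y : ℝ => -(y * exp (-y))) (-(1 * exp (-x) + x * (exp (-x) * (-1)))) x :=
    ((hasDerivAt_id x).mul (hasDerivAt_neg x).exp).neg
  rw [klOp, h1, h2.deriv]; ring

theorem klOp_const_mul (c : ℝ) (f : ℝ → ℝ) :
    klOp (fun y => c * f y) = fun y => c * klOp f y := by
  funext x
  have h1 : (fun y : ℝ => y * deriv (fun y : ℝ => c * f y) y)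
      = fun y => c * (y * deriv f y) := by
    funext y
    rw [deriv_const_mul_field]; ring
  rw [klOp, h1, deriv_const_mul_field, klOp]; ring

theorem klOp_mul_eval_mul_exp_neg (Q : Polynomial ℝ) :
    klOp (fun y : ℝ => y * Q.eval y * exp (-y))
      = fun y => (-1) * (y * (klStep Q).eval y * exp (-y)) := by
  have h0 (P : Polynomial ℝ) (x : ℝ) : HasDerivAt (fun y : ℝ => P.eval y * exp (-y))
      (P.derivative.eval x * exp (-x) + P.eval x * (exp (-x) * (-1))) x :=
    (P.hasDerivAt x).mul (hasDerivAt_neg x).exp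
  set R : Polynomial ℝ := Polynomial.X * (Q + Polynomial.X * Q.derivative - Polynomial.X * Q)
  have h1 : (fun y : ℝ => y * deriv (fun y : ℝ => y * Q.eval y * exp (-y)) y)
      = fun y => R.eval y * exp (-y) := by
    funext y
    have := h0 (Polynomial.X * Q) y
    simp only [Polynomial.eval_mul, Polynomial.eval_X] at this
    rw [this.deriv]
    simp [R]; ring
  funext x
  rw [klOp, h1, (h0 R x).deriv]
  simp [R, klStep]; ring

theorem klOp_iterate_exp_neg (k : ℕ) :
    klOp^[k + 1] (fun y : ℝ => exp (-y))
      = fun y => (-1) ^ (k + 1) * (y * (klCofactor k).eval y * exp (-y)) := by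
  induction k with
  | zero => funext x; simp [klOp_exp_neg, klCofactor]
  | succ k ih =>
    rw [Function.iterate_succ_apply', ih, klOp_const_mul, klOp_mul_eval_mul_exp_neg, klCofactor,
      klCofactor, Function.iterate_succ_apply']
    funext x; ring

theorem klPoly_succ (k : ℕ) (x : ℝ) : klPoly (k + 1) x = x * (klCofactor k).eval x := by
  rw [klPoly, klOp_iterate_exp_neg]
  have h1 : ((-1 : ℝ) ^ (k + 1)) * (-1) ^ (k + 1) = 1 := by rw [← mul_pow]; simp
  have h2 : exp x * exp (-x) = 1 := by rw [← Real.exp_add]; simp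
  calc _ = ((-1 : ℝ) ^ (k + 1) * (-1) ^ (k + 1)) * (exp x * exp (-x)) *
        (x * (klCofactor k).eval x) := by ring
    _ = _ := by rw [h1, h2]; ring

theorem klWeight_succ (k : ℕ) {u : ℝ} (hu : 0 < u) :
    klWeight (k + 1) u = exp (-u) * (klCofactor k).eval u := by
  rw [klWeight, klPoly_succ]; field_simp

theorem besselKi_eq_half_integral (τ x : ℝ) :
    besselKi τ x = 1 / 2 * ∫ v : ℝ, exp (-(x * cosh v)) * cos (τ * v) := by
  have h := integral_comp_abs (f := fun v => exp (-(x * cosh v)) * cos (τ * v))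
  have h' : (fun v : ℝ => exp (-(x * cosh |v|)) * cos (τ * |v|))
      = fun v => exp (-(x * cosh v)) * cos (τ * v) := by
    funext v
    rcases abs_choice v with h | h <;> simp [h]
  rw [h'] at h
  rw [h, besselKi]; ring

theorem measurable_besselKi : Measurable fun p : ℝ × ℝ => besselKi p.1 p.2 := by
  have : Measurable (Function.uncurry fun (p : ℝ × ℝ) (u : ℝ) =>
      exp (-(p.2 * cosh u)) * cos (p.1 * u)) := by
    unfold Function.uncurry
    apply Continuous.measurable
    fun_prop
  exact (this.stronglyMeasurable.integral_prod_right).measurable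

theorem exp_neg_le_rpow {z : ℝ} (hz : 0 < z) : exp (-z) ≤ z ^ (-(1 / 2) : ℝ) := by
  have h : z ^ (1 / 2 : ℝ) ≤ exp z := by
    rw [rpow_def_of_pos hz]
    apply exp_le_exp.2
    have := log_le_sub_one_of_pos hz
    have h2 := log_le_sub_one_of_pos (inv_pos.2 hz)
    rw [log_inv] at h2
    have : log z ≤ 2 * z := by linarith
    linarith
  rw [exp_neg, rpow_neg hz.le]
  exact inv_anti₀ (by positivity) h

theorem exp_neg_mul_cosh_le {x : ℝ} (hx : 0 < x) (v : ℝ) :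
    exp (-(x * cosh v)) ≤ x ^ (-(1 / 2) : ℝ) * cosh v ^ (-(1 / 2) : ℝ) := by
  have := exp_neg_le_rpow (mul_pos hx (cosh_pos v))
  rwa [mul_rpow hx.le (cosh_pos v).le] at this

theorem integrable_cosh_rpow : Integrable fun v : ℝ => cosh v ^ (-(1 / 2) : ℝ) := by
  have hc : Continuous fun v : ℝ => cosh v ^ (-(1 / 2) : ℝ) :=
    continuous_cosh.rpow_const fun v => Or.inl (cosh_pos v).ne'
  have hb (v : ℝ) : cosh v ^ (-(1 / 2) : ℝ) ≤ (1 / 2) ^ (-(1 / 2) : ℝ) * exp (-(1 / 2) * v) := by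
    have h1 : 1 / 2 * exp v ≤ cosh v := by
      rw [cosh_eq]; linarith [exp_pos (-v)]
    calc cosh v ^ (-(1 / 2) : ℝ) ≤ (1 / 2 * exp v) ^ (-(1 / 2) : ℝ) :=
          rpow_le_rpow_of_nonpos (by positivity) h1 (by norm_num)
      _ = _ := by
          rw [mul_rpow (by norm_num) (exp_pos v).le, ← exp_mul]; ring_nf
  have hI : IntegrableOn (fun v : ℝ => cosh v ^ (-(1 / 2) : ℝ)) (Ioi 0) := by
    refine Integrable.mono' ((integrableOn_exp_mul_Ioi (a := -(1 / 2)) (by norm_num) 0).const_mul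
      ((1 / 2) ^ (-(1 / 2) : ℝ))) hc.aestronglyMeasurable (ae_of_all _ fun v => ?_)
    rw [Real.norm_of_nonneg (rpow_nonneg (cosh_pos v).le _)]
    exact hb v
  have hI' : IntegrableOn (fun v : ℝ => cosh v ^ (-(1 / 2) : ℝ)) (Iio 0) := by
    have : IntegrableOn (fun v : ℝ => cosh v ^ (-(1 / 2) : ℝ)) (Ioi (-0)) := by simpa using hI
    simpa using this.comp_neg_Iio
  rw [← integrableOn_univ, ← Iio_union_Ici (a := (0 : ℝ))]
  exact hI'.union ((integrableOn_Ici_iff_integrableOn_Ioi).2 hI)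

theorem integrable_exp_neg_mul_cosh {x : ℝ} (hx : 0 < x) :
    Integrable fun v : ℝ => exp (-(x * cosh v)) := by
  refine Integrable.mono' (integrable_cosh_rpow.const_mul (x ^ (-(1 / 2) : ℝ)))
    (by fun_prop) (ae_of_all _ fun v => ?_)
  rw [Real.norm_of_nonneg (exp_pos _).le]
  exact exp_neg_mul_cosh_le hx v

theorem abs_exp_mul_cos_le (x τ v : ℝ) :
    |exp (-(x * cosh v)) * cos (τ * v)| ≤ exp (-(x * cosh v)) := by
  rw [abs_mul, abs_of_pos (exp_pos _)]
  exact mul_le_of_le_one_right (exp_pos _).le (abs_cos_le_one _)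

theorem abs_exp_mul_sin_le (x τ v : ℝ) :
    |exp (-(x * cosh v)) * sin (τ * v)| ≤ exp (-(x * cosh v)) := by
  rw [abs_mul, abs_of_pos (exp_pos _)]
  exact mul_le_of_le_one_right (exp_pos _).le (abs_sin_le_one _)

theorem integrable_exp_neg_mul_cosh_mul_cos {x : ℝ} (hx : 0 < x) (τ : ℝ) :
    Integrable fun v : ℝ => exp (-(x * cosh v)) * cos (τ * v) :=
  (integrable_exp_neg_mul_cosh hx).mono' (by fun_prop)
    (ae_of_all _ fun v => abs_exp_mul_cos_le x τ v)

theorem integrable_exp_neg_mul_cosh_mul_sin {x : ℝ} (hx : 0 < x) (τ : ℝ) :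
    Integrable fun v : ℝ => exp (-(x * cosh v)) * sin (τ * v) :=
  (integrable_exp_neg_mul_cosh hx).mono' (by fun_prop)
    (ae_of_all _ fun v => abs_exp_mul_sin_le x τ v)

theorem abs_besselKi_le (τ : ℝ) {x : ℝ} (hx : 0 < x) :
    |besselKi τ x| ≤ (∫ v : ℝ, cosh v ^ (-(1 / 2) : ℝ)) * x ^ (-(1 / 2) : ℝ) := by
  have h1 : ‖∫ v : ℝ, exp (-(x * cosh v)) * cos (τ * v)‖
      ≤ ∫ v : ℝ, x ^ (-(1 / 2) : ℝ) * cosh v ^ (-(1 / 2) : ℝ) :=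
    norm_integral_le_of_norm_le (f := fun v : ℝ => exp (-(x * cosh v)) * cos (τ * v)) (integrable_cosh_rpow.const_mul _)
      (ae_of_all _ fun v => (abs_exp_mul_cos_le x τ v).trans (exp_neg_mul_cosh_le hx v))
  rw [integral_const_mul, Real.norm_eq_abs] at h1
  rw [besselKi_eq_half_integral, abs_mul]
  have : |(1 / 2 : ℝ)| = 1 / 2 := by norm_num
  rw [this]
  have := abs_nonneg (∫ v : ℝ, exp (-(x * cosh v)) * cos (τ * v))
  linarith

theorem integrable_prod_mul_exp_cosh {φ : ℝ → ℝ} (hm : Measurable φ)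
    (hφ : IntegrableOn (fun u => φ u * u ^ (-(1 / 2) : ℝ)) (Ioi 0)) (τ : ℝ) :
    Integrable (fun z : ℝ × ℝ => φ z.1 * (exp (-(z.1 * cosh z.2)) * cos (τ * z.2)))
      ((volume.restrict (Ioi 0)).prod volume) := by
  have hc : Continuous fun z : ℝ × ℝ => exp (-(z.1 * cosh z.2)) * cos (τ * z.2) := by fun_prop
  refine (hφ.norm.mul_prod integrable_cosh_rpow).mono'
    ((hm.comp measurable_fst).mul hc.measurable).aestronglyMeasurable ?_
  have : (volume.restrict (Ioi (0 : ℝ))).prod (volume : Measure ℝ)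
      = (volume.prod volume).restrict (Ioi 0 ×ˢ univ) := by
    rw [← Measure.prod_restrict, Measure.restrict_univ]
  rw [this]
  refine (ae_restrict_iff' (measurableSet_Ioi.prod MeasurableSet.univ)).2
    (ae_of_all _ fun z hz => ?_)
  have hz1 : 0 < z.1 := hz.1
  simp only [norm_mul, Real.norm_eq_abs]
  rw [mul_assoc, abs_of_nonneg (rpow_nonneg hz1.le _), ← abs_mul]
  gcongr
  exact (abs_exp_mul_cos_le z.1 τ z.2).trans (exp_neg_mul_cosh_le hz1 z.2)

theorem integrableOn_mul_besselKi {φ : ℝ → ℝ} (hm : Measurable φ)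
    (hφ : IntegrableOn (fun u => φ u * u ^ (-(1 / 2) : ℝ)) (Ioi 0)) (τ : ℝ) :
    IntegrableOn (fun u => φ u * besselKi τ u) (Ioi 0) := by
  refine Integrable.mono' ((hφ.norm).const_mul (∫ v : ℝ, cosh v ^ (-(1 / 2) : ℝ)))
    (hm.mul (measurable_besselKi.comp (measurable_const.prodMk measurable_id))).aestronglyMeasurable
    ((ae_restrict_iff' measurableSet_Ioi).2 (ae_of_all _ fun u (hu : 0 < u) => ?_))
  simp only [norm_mul, Real.norm_eq_abs]
  rw [abs_of_nonneg (rpow_nonneg hu.le (-(1 / 2)))]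
  calc _ ≤ |φ u| * ((∫ v : ℝ, cosh v ^ (-(1 / 2) : ℝ)) * u ^ (-(1 / 2) : ℝ)) := by
        gcongr; exact abs_besselKi_le τ hu
    _ = _ := by ring

theorem setIntegral_mul_besselKi {φ : ℝ → ℝ} (hm : Measurable φ)
    (hφ : IntegrableOn (fun u => φ u * u ^ (-(1 / 2) : ℝ)) (Ioi 0)) (τ : ℝ) :
    ∫ u in Ioi 0, φ u * besselKi τ u
      = 1 / 2 * ∫ v : ℝ, cos (τ * v) * ∫ u in Ioi 0, φ u * exp (-(u * cosh v)) := by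
  have h := integral_integral_swap (μ := volume.restrict (Ioi (0 : ℝ))) (ν := (volume : Measure ℝ))
    (f := fun u v => φ u * (exp (-(u * cosh v)) * cos (τ * v)))
    (integrable_prod_mul_exp_cosh hm hφ τ)
  calc _ = 1 / 2 * ∫ u in Ioi 0, ∫ v : ℝ, φ u * (exp (-(u * cosh v)) * cos (τ * v)) := by
        rw [← integral_const_mul]
        congr 1 with u
        rw [besselKi_eq_half_integral, integral_const_mul]; ring
    _ = _ := by
        rw [h]
        congr 2 with v
        rw [← integral_const_mul]
        congr 1 with u
        ring

theorem integrable_inv_one_add_cosh_pow (n : ℕ) :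
    Integrable fun s : ℝ => ((1 + cosh s) ^ (n + 1))⁻¹ := by
  have hp (s : ℝ) : 0 < 1 + cosh s := by linarith [cosh_pos s]
  refine integrable_cosh_rpow.mono'
    (Continuous.inv₀ (by fun_prop) fun s => (pow_pos (hp s) _).ne').aestronglyMeasurable
    (ae_of_all _ fun s => ?_)
  rw [Real.norm_of_nonneg (inv_nonneg.2 (pow_pos (hp s) _).le), rpow_neg (cosh_pos s).le]
  refine inv_anti₀ (rpow_pos_of_pos (cosh_pos s) _) ?_
  calc cosh s ^ (1 / 2 : ℝ) ≤ cosh s ^ (1 : ℝ) :=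
        rpow_le_rpow_of_exponent_le (one_le_cosh s) (by norm_num)
    _ = cosh s := rpow_one _
    _ ≤ 1 + cosh s := by linarith
    _ ≤ _ := le_self_pow₀ (by linarith [cosh_pos s]) (by simp)

theorem sigmoid_mul_one_sub (s : ℝ) :
    sigmoid s * (1 - sigmoid s) = (2 * (1 + cosh s))⁻¹ := by
  have h1 : 0 < 1 + exp (-s) := by positivity
  have h2 : exp s * exp (-s) = 1 := by rw [← Real.exp_add]; simp
  have h3 : 0 < 1 + cosh s := by linarith [cosh_pos s]
  rw [sigmoid_def, ← mul_eq_one_iff_eq_inv₀ (by positivity)]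
  field_simp
  rw [cosh_eq]
  nlinarith

theorem sigmoid_cpow_mul_cpow (n : ℕ) (τ s : ℝ) :
    (sigmoid s : ℂ) ^ ((n : ℂ) + τ * Complex.I) * (1 - sigmoid s : ℂ) ^ ((n : ℂ) - τ * Complex.I)
      = ((sigmoid s * (1 - sigmoid s) : ℝ) : ℂ) ^ n * Complex.exp (τ * s * Complex.I) := by
  have ha := sigmoid_pos s
  have hb : 0 < 1 - sigmoid s := by linarith [sigmoid_lt_one s]
  have hlog : Real.log (sigmoid s) = Real.log (1 - sigmoid s) + s := by
    have h : 1 - sigmoid s = sigmoid s * exp (-s) := by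
      rw [sigmoid_mul_rexp_neg, sigmoid_neg]
    rw [h, Real.log_mul ha.ne' (exp_pos _).ne', Real.log_exp]; ring
  have ha' : (sigmoid s : ℂ) ≠ 0 := by exact_mod_cast ha.ne'
  have hb' : ((1 - sigmoid s : ℝ) : ℂ) ≠ 0 := by exact_mod_cast hb.ne'
  have hc : (1 - sigmoid s : ℂ) = ((1 - sigmoid s : ℝ) : ℂ) := by push_cast; rfl
  rw [hc, Complex.cpow_add _ _ ha', Complex.cpow_sub _ _ hb', Complex.cpow_natCast,
    Complex.cpow_natCast, Complex.cpow_def_of_ne_zero ha', Complex.cpow_def_of_ne_zero hb',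
    ← Complex.ofReal_log ha.le, ← Complex.ofReal_log hb.le, hlog, Complex.ofReal_mul, mul_pow]
  rw [mul_div_assoc', div_eq_iff (Complex.exp_ne_zero _)]
  have : Complex.exp (((Real.log (1 - sigmoid s) + s : ℝ) : ℂ) * (τ * Complex.I))
      = Complex.exp (τ * s * Complex.I)
        * Complex.exp ((Real.log (1 - sigmoid s) : ℂ) * (τ * Complex.I)) := by
    rw [← Complex.exp_add]; push_cast; ring_nf
  rw [this]; ring

theorem betaIntegral_eq_integral_cosh (n : ℕ) (τ : ℝ) :
    Complex.betaIntegral (n + 1 + τ * Complex.I) (n + 1 - τ * Complex.I)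
      = ∫ s : ℝ, (((2 * (1 + cosh s)) ^ (n + 1))⁻¹ : ℝ) * Complex.exp (τ * s * Complex.I) := by
  rw [Complex.betaIntegral, intervalIntegral.integral_of_le zero_le_one,
    integral_Ioc_eq_integral_Ioo, ← range_sigmoid, ← image_univ,
    integral_image_eq_integral_abs_deriv_smul MeasurableSet.univ
      (fun x _ => (hasDerivAt_sigmoid x).hasDerivWithinAt) sigmoid_injective.injOn,
    Measure.restrict_univ]
  congr 1 with s
  have hp : 0 ≤ sigmoid s * (1 - sigmoid s) :=
    mul_nonneg (sigmoid_nonneg s) (by linarith [sigmoid_lt_one s])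
  have e1 : (n + 1 + τ * Complex.I : ℂ) - 1 = n + τ * Complex.I := by ring
  have e2 : (n + 1 - τ * Complex.I : ℂ) - 1 = n - τ * Complex.I := by ring
  rw [e1, e2, sigmoid_cpow_mul_cpow, abs_of_nonneg hp, Complex.real_smul, sigmoid_mul_one_sub,
    ← mul_assoc, ← inv_pow, pow_succ']
  push_cast
  ring

theorem integral_cos_div_one_add_cosh_pow (n : ℕ) (τ : ℝ) :
    ∫ s : ℝ, cos (τ * s) * ((1 + cosh s) ^ (n + 1))⁻¹
      = 2 ^ (n + 1) *
        (Complex.betaIntegral (n + 1 + τ * Complex.I) (n + 1 - τ * Complex.I)).re := by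
  have hI : Integrable fun s : ℝ =>
      (((2 * (1 + cosh s)) ^ (n + 1))⁻¹ : ℝ) * Complex.exp (τ * s * Complex.I) := by
    refine Integrable.mono' ((integrable_inv_one_add_cosh_pow n).const_mul ((2 ^ (n + 1))⁻¹)) ?_
      (ae_of_all _ fun s => ?_)
    · refine Continuous.aestronglyMeasurable ?_
      refine (Complex.continuous_ofReal.comp (Continuous.inv₀ (by fun_prop) fun s => ?_)).mul
        (by fun_prop)
      have := cosh_pos s
      positivity
    · have := cosh_pos s
      rw [norm_mul, show (τ * s * Complex.I : ℂ) = ((τ * s : ℝ) : ℂ) * Complex.I by push_cast; rfl,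
        Complex.norm_exp_ofReal_mul_I, Complex.norm_real, Real.norm_of_nonneg (by positivity),
        mul_pow, mul_inv, mul_one]
  rw [betaIntegral_eq_integral_cosh, ← RCLike.re_eq_complex_re, ← integral_re hI,
    ← integral_const_mul]
  congr 1 with s
  rw [RCLike.re_eq_complex_re, Complex.re_ofReal_mul,
    show (τ * s * Complex.I : ℂ) = ((τ * s : ℝ) : ℂ) * Complex.I by push_cast; rfl,
    Complex.exp_ofReal_mul_I_re, mul_pow, mul_inv]
  field_simp

theorem betaIntegral_succ_succ (n : ℕ) (τ : ℝ) :
    (2 * n + 3) * (2 * n + 2) *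
        (Complex.betaIntegral ((n + 1 : ℕ) + 1 + τ * Complex.I) ((n + 1 : ℕ) + 1 - τ * Complex.I)).re
      = ((n + 1) ^ 2 + τ ^ 2) *
        (Complex.betaIntegral (n + 1 + τ * Complex.I) (n + 1 - τ * Complex.I)).re := by
  have hp : (0 : ℝ) < (n : ℝ) + 1 := by positivity
  set a : ℂ := n + 1 + τ * Complex.I with ha
  set b : ℂ := n + 1 - τ * Complex.I with hb
  have har : 0 < a.re := by simpa [ha] using hp
  have hbr : 0 < b.re := by simpa [hb] using hp
  have e1 : ((n + 1 : ℕ) + 1 + τ * Complex.I : ℂ) = a + 1 := by rw [ha]; push_cast; ring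
  have e2 : ((n + 1 : ℕ) + 1 - τ * Complex.I : ℂ) = b + 1 := by rw [hb]; push_cast; ring
  have ha0 : a ≠ 0 := fun h => by simp [h] at har
  have hb0 : b ≠ 0 := fun h => by simp [h] at hbr
  have hab : a * b = (((n + 1) ^ 2 + τ ^ 2 : ℝ) : ℂ) := by
    rw [ha, hb]; push_cast; ring_nf; rw [Complex.I_sq]; ring
  have hs : a + b = ((2 * n + 2 : ℕ) : ℂ) := by rw [ha, hb]; push_cast; ring
  have h1 : a + b ≠ 0 := by rw [hs]; exact Nat.cast_ne_zero.2 (by omega)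
  have h2 : a + b + 1 ≠ 0 := by rw [hs]; exact Nat.cast_add_one_ne_zero _
  have key : (((2 * n + 3) * (2 * n + 2) : ℝ) : ℂ) * Complex.betaIntegral (a + 1) (b + 1)
      = (((n + 1) ^ 2 + τ ^ 2 : ℝ) : ℂ) * Complex.betaIntegral a b := by
    rw [Complex.betaIntegral_eq_Gamma_mul_div _ _ har hbr,
      Complex.betaIntegral_eq_Gamma_mul_div _ _ (by simp; linarith) (by simp; linarith),
      Complex.Gamma_add_one _ ha0, Complex.Gamma_add_one _ hb0,
      show a + 1 + (b + 1) = (a + b + 1) + 1 by ring,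
      Complex.Gamma_add_one (a + b + 1) h2,
      Complex.Gamma_add_one (a + b) h1, ← hab]
    have hG : Complex.Gamma (a + b) ≠ 0 := Complex.Gamma_ne_zero_of_re_pos (by simp; linarith)
    have h3 : (((2 * n + 3) * (2 * n + 2) : ℝ) : ℂ) = (a + b + 1) * (a + b) := by
      rw [hs]; push_cast; ring
    rw [h3]
    field_simp
  have := congrArg Complex.re key
  rw [Complex.re_ofReal_mul, Complex.re_ofReal_mul] at this
  rw [e1, e2, this]

theorem betaIntegral_one_add_mul_I {τ : ℝ} (hτ : 0 < τ) :
    (Complex.betaIntegral (1 + τ * Complex.I) (1 - τ * Complex.I)).re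
      = π * τ / sinh (π * τ) := by
  have h0 : (τ * Complex.I : ℂ) ≠ 0 := by simp [hτ.ne']
  rw [Complex.betaIntegral_eq_Gamma_mul_div _ _ (by simp) (by simp),
    show (1 + τ * Complex.I + (1 - τ * Complex.I) : ℂ) = (1 : ℕ) + 1 by push_cast; ring,
    Complex.Gamma_nat_eq_factorial, add_comm (1 : ℂ), Complex.Gamma_add_one _ h0, mul_assoc,
    Complex.Gamma_mul_Gamma_one_sub, ← mul_assoc, Complex.sin_mul_I]
  have h1 : (τ * Complex.I : ℂ) * (π / (Complex.sinh (π * τ) * Complex.I)) / (Nat.factorial 1 : ℂ)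
      = ((π * τ / sinh (π * τ) : ℝ) : ℂ) := by
    have : Complex.sinh (π * τ) ≠ 0 := by
      rw [← Complex.ofReal_mul, ← Complex.ofReal_sinh]
      exact_mod_cast (sinh_pos_iff.2 (by positivity)).ne'
    push_cast
    field_simp
    simp
  rw [h1, Complex.ofReal_re]

theorem integrableOn_eval_mul_exp_neg_mul_mul_rpow (Q : Polynomial ℝ) {b s : ℝ} (hb : 0 < b)
    (hs : -1 < s) : IntegrableOn (fun u : ℝ => Q.eval u * exp (-(b * u)) * u ^ s) (Ioi 0) := by
  induction Q using Polynomial.induction_on' with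
  | add p q hp hq =>
    refine (hp.add hq).congr (ae_of_all _ fun u => ?_)
    simp only [Pi.add_apply, Polynomial.eval_add]; ring
  | monomial n c =>
    have h := integrableOn_rpow_mul_exp_neg_mul_rpow (p := 1) (s := n + s) (b := b)
      (by have : (0 : ℝ) ≤ n := by positivity
          linarith) one_pos hb
    refine (h.const_mul c).congr
      ((ae_restrict_iff' measurableSet_Ioi).2 (ae_of_all _ fun u (hu : 0 < u) => ?_))
    simp only [Polynomial.eval_monomial]
    rw [rpow_add hu, rpow_natCast, rpow_one, neg_mul]; ring

theorem integrableOn_eval_mul_exp_neg_mul_rpow (Q : Polynomial ℝ) :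
    IntegrableOn (fun u : ℝ => Q.eval u * exp (-u) * u ^ (-(1 / 2) : ℝ)) (Ioi 0) := by
  simpa using integrableOn_eval_mul_exp_neg_mul_mul_rpow Q one_pos
    (s := -(1 / 2)) (by norm_num)

theorem measurable_eval_mul_exp_neg (Q : Polynomial ℝ) :
    Measurable fun u : ℝ => Q.eval u * exp (-u) :=
  (Q.continuous.mul (by fun_prop)).measurable

theorem integrableOn_eval_mul_exp_neg_mul_besselKi (Q : Polynomial ℝ) (τ : ℝ) :
    IntegrableOn (fun u : ℝ => Q.eval u * exp (-u) * besselKi τ u) (Ioi 0) :=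
  integrableOn_mul_besselKi (measurable_eval_mul_exp_neg Q)
    (integrableOn_eval_mul_exp_neg_mul_rpow Q) τ

/-- The integral of `Q(u) e^{-u} K_{iτ}(u)` over `u > 0`. -/
noncomputable def besselKiMoment (τ : ℝ) (Q : Polynomial ℝ) : ℝ :=
  ∫ u in Ioi 0, Q.eval u * exp (-u) * besselKi τ u

theorem besselKiMoment_add (τ : ℝ) (P Q : Polynomial ℝ) :
    besselKiMoment τ (P + Q) = besselKiMoment τ P + besselKiMoment τ Q := by
  rw [besselKiMoment, besselKiMoment, besselKiMoment,
    ← integral_add (integrableOn_eval_mul_exp_neg_mul_besselKi P τ)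
      (integrableOn_eval_mul_exp_neg_mul_besselKi Q τ)]
  congr 1 with u
  rw [Polynomial.eval_add]; ring

theorem besselKiMoment_monomial (τ : ℝ) (n : ℕ) (c : ℝ) :
    besselKiMoment τ (Polynomial.monomial n c) = c * (n.factorial * 2 ^ n *
      (Complex.betaIntegral (n + 1 + τ * Complex.I) (n + 1 - τ * Complex.I)).re) := by
  rw [besselKiMoment, setIntegral_mul_besselKi (measurable_eval_mul_exp_neg _)
    (integrableOn_eval_mul_exp_neg_mul_rpow _)]
  have h (v : ℝ) : ∫ u in Ioi 0, (Polynomial.monomial n c).eval u * exp (-u) * exp (-(u * cosh v))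
      = c * (n.factorial * ((1 + cosh v) ^ (n + 1))⁻¹) := by
    have hv : 0 < 1 + cosh v := by linarith [cosh_pos v]
    have h := integral_rpow_mul_exp_neg_mul_Ioi (a := n + 1) (r := 1 + cosh v) (by positivity) hv
    rw [Real.Gamma_nat_eq_factorial] at h
    calc _ = c * ∫ u in Ioi 0, u ^ ((n + 1 : ℝ) - 1) * exp (-((1 + cosh v) * u)) := by
          rw [← integral_const_mul]
          congr 1 with u
          rw [Polynomial.eval_monomial, mul_assoc, ← Real.exp_add, add_sub_cancel_right,
            rpow_natCast, mul_assoc]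
          ring_nf
      _ = _ := by
          rw [h, one_div, inv_rpow hv.le, show (n + 1 : ℝ) = ((n + 1 : ℕ) : ℝ) by push_cast; rfl,
            rpow_natCast]
          ring
  simp_rw [h]
  calc _ = 1 / 2 * (c * n.factorial * ∫ v : ℝ, cos (τ * v) * ((1 + cosh v) ^ (n + 1))⁻¹) := by
        rw [← integral_const_mul, ← integral_const_mul, ← integral_const_mul]
        congr 1 with v
        ring
    _ = _ := by
        rw [integral_cos_div_one_add_cosh_pow, pow_succ]; ring

theorem klStep_add (P Q : Polynomial ℝ) : klStep (P + Q) = klStep P + klStep Q := by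
  simp only [klStep, Polynomial.derivative_add]; ring

theorem klStep_monomial (n : ℕ) (c : ℝ) :
    klStep (Polynomial.monomial n c)
      = Polynomial.monomial n ((n + 1) ^ 2 * c) + Polynomial.monomial (n + 1) (-(2 * n + 3) * c) := by
  apply Polynomial.funext
  intro x
  rcases n with _ | _ | n <;>
  simp [klStep] <;> ring

theorem besselKiMoment_klStep (τ : ℝ) (Q : Polynomial ℝ) :
    besselKiMoment τ (klStep Q) = -τ ^ 2 * besselKiMoment τ Q := by
  induction Q using Polynomial.induction_on' with
  | add p q hp hq => rw [klStep_add, besselKiMoment_add, besselKiMoment_add, hp, hq]; ring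
  | monomial n c =>
    have h := betaIntegral_succ_succ n τ
    rw [klStep_monomial, besselKiMoment_add, besselKiMoment_monomial, besselKiMoment_monomial,
      besselKiMoment_monomial, Nat.factorial_succ, pow_succ]
    set A := (Complex.betaIntegral (n + 1 + τ * Complex.I) (n + 1 - τ * Complex.I)).re
    set B := (Complex.betaIntegral ((n + 1 : ℕ) + 1 + τ * Complex.I)
      ((n + 1 : ℕ) + 1 - τ * Complex.I)).re
    push_cast
    linear_combination (-c * n.factorial * 2 ^ n) * h

theorem besselKiMoment_klCofactor {τ : ℝ} (hτ : 0 < τ) (k : ℕ) :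
    besselKiMoment τ (klCofactor k)
      = (-1) ^ (k + 1) * τ ^ (2 * k) * (π * τ / sinh (π * τ)) := by
  induction k with
  | zero =>
    have := besselKiMoment_monomial τ 0 (-1)
    simp only [Nat.cast_zero, zero_add, betaIntegral_one_add_mul_I hτ] at this
    simpa [klCofactor] using this
  | succ k ih =>
    rw [klCofactor, Function.iterate_succ_apply', besselKiMoment_klStep, ← klCofactor, ih]
    ring

/-- The kernel of the Kontorovich-Lebedev convolution. -/
noncomputable def klKernel (x u y : ℝ) : ℝ :=
  exp (-(1 / 2) * (x * ((u ^ 2 + y ^ 2) / (u * y)) + y * u / x))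

theorem measurable_klKernel (x : ℝ) : Measurable fun z : ℝ × ℝ => klKernel x z.1 z.2 := by
  unfold klKernel; fun_prop

theorem measurable_klKernel_div (x u : ℝ) : Measurable fun y : ℝ => klKernel x u y / y := by
  unfold klKernel; fun_prop

theorem klKernel_eq {x u y : ℝ} (hx : 0 < x) (hu : 0 < u) (hy : 0 < y) :
    klKernel x u y = exp (-(x * u / 2 / y)) * exp (-((x / u + u / x) / 2 * y)) := by
  rw [klKernel, ← Real.exp_add]
  congr 1
  field_simp
  ring

theorem integrableOn_klKernel_div {x u : ℝ} (hx : 0 < x) (hu : 0 < u) :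
    IntegrableOn (fun y => klKernel x u y / y * y ^ (-(1 / 2) : ℝ)) (Ioi 0) := by
  have hd : 0 < (x / u + u / x) / 2 := by positivity
  have h := integrableOn_rpow_mul_exp_neg_mul_rpow (p := 1) (s := -(1 / 2))
    (b := (x / u + u / x) / 2) (by norm_num) one_pos hd
  refine Integrable.mono' (h.const_mul (x * u / 2)⁻¹)
    ((measurable_klKernel_div x u).mul (by fun_prop)).aestronglyMeasurable
    ((ae_restrict_iff' measurableSet_Ioi).2 (ae_of_all _ fun y (hy : 0 < y) => ?_))
  have hc : 0 < x * u / 2 / y := by positivity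
  have h1 : exp (-(x * u / 2 / y)) ≤ (x * u / 2 / y)⁻¹ := by
    rw [exp_neg]
    exact inv_anti₀ hc (by linarith [add_one_le_exp (x * u / 2 / y)])
  have hk : 0 ≤ klKernel x u y := (exp_pos _).le
  rw [Real.norm_of_nonneg (by positivity), klKernel_eq hx hu hy, rpow_one]
  calc _ ≤ (x * u / 2 / y)⁻¹ * exp (-((x / u + u / x) / 2 * y)) / y * y ^ (-(1 / 2) : ℝ) := by
        gcongr
    _ = _ := by rw [neg_mul ((x / u + u / x) / 2)]; field_simp

theorem setIntegral_Ioi_div_eq (g : ℝ → ℝ) :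
    ∫ y in Ioi 0, g y / y = ∫ c : ℝ, g (exp c) := by
  rw [← range_exp, ← image_univ, integral_image_eq_integral_abs_deriv_smul MeasurableSet.univ
    (fun x _ => (Real.hasDerivAt_exp x).hasDerivWithinAt) exp_injective.injOn,
    Measure.restrict_univ]
  congr 1 with c
  rw [abs_of_pos (exp_pos c), smul_eq_mul, mul_div_cancel₀ _ (exp_pos c).ne']

theorem setIntegral_klKernel_div_mul_exp {x u : ℝ} (hx : 0 < x) (hu : 0 < u) (s : ℝ) :
    ∫ y in Ioi 0, klKernel x u y / y * exp (-(y * cosh s))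
      = ∫ b : ℝ, exp (-(x * cosh (s - b))) * exp (-(u * cosh b)) := by
  have hq : 0 < x * exp (-s) + u := by positivity
  have h1 : ∫ y in Ioi 0, klKernel x u y / y * exp (-(y * cosh s))
      = ∫ y in Ioi 0, (klKernel x u y * exp (-(y * cosh s))) / y := by
    congr 1 with y; ring
  rw [h1, setIntegral_Ioi_div_eq,
    ← integral_sub_left_eq_self _ volume (log (x * u / (x * exp (-s) + u)))]
  congr 1 with b
  rw [Real.exp_sub, exp_log (by positivity), klKernel_eq hx hu (by positivity), ← Real.exp_add,
    ← Real.exp_add, ← Real.exp_add]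
  congr 1
  rw [cosh_eq, cosh_eq, cosh_eq, neg_sub, Real.exp_sub, Real.exp_sub, exp_neg, exp_neg]
  rw [exp_neg] at hq
  have := exp_pos b
  have := exp_pos s
  have h4 : (x * (exp s)⁻¹ + u) = (x + u * exp s) / exp s := by field_simp
  rw [h4]
  have h5 : 0 < x + u * exp s := by positivity
  field_simp
  ring

theorem integral_exp_neg_mul_cosh_mul_sin (x τ : ℝ) :
    ∫ v : ℝ, exp (-(x * cosh v)) * sin (τ * v) = 0 := by
  have h := integral_neg_eq_self (fun v : ℝ => exp (-(x * cosh v)) * sin (τ * v)) volume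
  simp only [cosh_neg, mul_neg, sin_neg, integral_neg] at h
  linarith

/-- Macdonald's product formula for `K_{iτ}`. -/
theorem setIntegral_klKernel_div_mul_besselKi {x u : ℝ} (hx : 0 < x) (hu : 0 < u) (τ : ℝ) :
    ∫ y in Ioi 0, klKernel x u y / y * besselKi τ y = 2 * besselKi τ x * besselKi τ u := by
  rw [setIntegral_mul_besselKi (measurable_klKernel_div x u) (integrableOn_klKernel_div hx hu)]
  simp_rw [setIntegral_klKernel_div_mul_exp hx hu]
  let f : ℝ × ℝ → ℝ := fun z =>
    exp (-(x * cosh z.1)) * exp (-(u * cosh z.2)) * cos (τ * (z.1 + z.2))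
  have hf : Integrable f (volume.prod volume) := by
    refine ((integrable_exp_neg_mul_cosh hx).mul_prod (integrable_exp_neg_mul_cosh hu)).mono'
      (Continuous.aestronglyMeasurable (by fun_prop)) (ae_of_all _ fun z => ?_)
    rw [norm_mul, Real.norm_of_nonneg (by positivity), Real.norm_eq_abs]
    exact mul_le_of_le_one_right (by positivity) (abs_cos_le_one _)
  have hf' : Integrable (Function.uncurry fun s b : ℝ => f (s - b, b)) (volume.prod volume) :=
    (measurePreserving_sub_prod volume volume).integrable_comp_of_integrable hf
  have hcx := integrable_exp_neg_mul_cosh_mul_cos hx τ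
  have hsx := integrable_exp_neg_mul_cosh_mul_sin hx τ
  have hin (b : ℝ) : ∫ a : ℝ, f (a, b)
      = 2 * besselKi τ x * (exp (-(u * cosh b)) * cos (τ * b)) := by
    calc _ = ∫ a : ℝ, (exp (-(u * cosh b)) * cos (τ * b)) * (exp (-(x * cosh a)) * cos (τ * a))
          - (exp (-(u * cosh b)) * sin (τ * b)) * (exp (-(x * cosh a)) * sin (τ * a)) := by
          congr 1 with a
          simp only [f]
          rw [mul_add, cos_add]; ring
      _ = _ := by
          rw [integral_sub (hcx.const_mul _) (hsx.const_mul _), integral_const_mul,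
            integral_const_mul, integral_exp_neg_mul_cosh_mul_sin, besselKi_eq_half_integral]
          ring
  calc _ = 1 / 2 * ∫ s : ℝ, ∫ b : ℝ, f (s - b, b) := by
        congr 2 with s
        rw [← integral_const_mul]
        congr 1 with b
        simp only [f]
        rw [sub_add_cancel]; ring
    _ = 1 / 2 * ∫ b : ℝ, ∫ s : ℝ, f (s - b, b) := by rw [integral_integral_swap hf']
    _ = 1 / 2 * ∫ b : ℝ, ∫ a : ℝ, f (a, b) := by
        congr 2 with b
        exact integral_sub_right_eq_self (fun a => f (a, b)) b
    _ = _ := by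
        simp_rw [hin]
        rw [integral_const_mul, besselKi_eq_half_integral τ u]; ring

theorem integrable_exp_neg_sq_mul_exp {a : ℝ} (ha : 0 < a) (c : ℝ) :
    Integrable fun x : ℝ => exp (-(a * x ^ 2)) * exp (c * x) := by
  have h := (integrable_cexp_quadratic (b := (a : ℂ)) (by simpa using ha) (c : ℂ) 0).norm
  refine h.congr (ae_of_all _ fun x => ?_)
  have : (-(a : ℂ) * x ^ 2 + c * x + 0) = ((-(a * x ^ 2) + c * x : ℝ) : ℂ) := by push_cast; ring
  simp only [this, Complex.norm_exp_ofReal, Real.exp_add]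

theorem integral_gaussian_mul_exp_mul_sin {t : ℝ} (ht : 0 < t) (c u : ℝ) :
    ∫ x : ℝ, exp (-(t * x ^ 2 / 2)) * exp (c * x) * sin (u * x)
      = √(2 * π / t) * (exp ((c ^ 2 - u ^ 2) / (2 * t)) * sin (c * u / t)) := by
  have ht' : 0 < ((t / 2 : ℝ) : ℂ).re := by rw [Complex.ofReal_re]; positivity
  have hI := integrable_cexp_quadratic ht' (c + u * Complex.I) 0
  have h := integral_cexp_quadratic (b := -((t / 2 : ℝ) : ℂ)) (by simpa using ht)
    (c + u * Complex.I) 0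
  have h1 := congrArg Complex.im h
  rw [← RCLike.im_eq_complex_im, ← integral_im hI] at h1
  have e1 (x : ℝ) : RCLike.im (Complex.exp (-((t / 2 : ℝ) : ℂ) * x ^ 2
      + (c + u * Complex.I) * x + 0)) = exp (-(t * x ^ 2 / 2)) * exp (c * x) * sin (u * x) := by
    rw [RCLike.im_eq_complex_im, Complex.exp_im, ← Real.exp_add]
    congr 2
    · simp [← Complex.ofReal_pow]; ring
    · simp [← Complex.ofReal_pow]
  simp_rw [e1] at h1
  rw [h1, RCLike.im_eq_complex_im]
  have e2 : ((π : ℂ) / - -((t / 2 : ℝ) : ℂ)) ^ (1 / 2 : ℂ) = ((√(2 * π / t) : ℝ) : ℂ) := by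
    rw [sqrt_eq_rpow, Complex.ofReal_cpow (by positivity)]
    congr 1
    · push_cast; field_simp
    · push_cast; rfl
  have e3 : (0 - (c + u * Complex.I) ^ 2 / (4 * -((t / 2 : ℝ) : ℂ)))
      = (((c ^ 2 - u ^ 2) / (2 * t) : ℝ) : ℂ) + ((c * u / t : ℝ) : ℂ) * Complex.I := by
    have : (t : ℂ) ≠ 0 := by exact_mod_cast ht.ne'
    push_cast
    field_simp
    ring_nf
    rw [Complex.I_sq]; ring
  rw [e2, e3, Complex.im_ofReal_mul, Complex.exp_im, Complex.add_re,
    Complex.add_im, Complex.re_ofReal_mul, Complex.im_ofReal_mul, Complex.ofReal_re,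
    Complex.ofReal_im, Complex.I_re, Complex.I_im, mul_zero, mul_one, add_zero, zero_add]

theorem setIntegral_gaussian_mul_sinh_mul_sin {t : ℝ} (ht : 0 < t) (c u : ℝ) :
    ∫ x in Ioi 0, exp (-(t * x ^ 2 / 2)) * sinh (c * x) * sin (x * u)
      = √(2 * π / t) / 2 * (exp ((c ^ 2 - u ^ 2) / (2 * t)) * sin (c * u / t)) := by
  have h := integral_comp_abs (f := fun x => exp (-(t * x ^ 2 / 2)) * sinh (c * x) * sin (x * u))
  have h' : (fun x : ℝ => exp (-(t * |x| ^ 2 / 2)) * sinh (c * |x|) * sin (|x| * u))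
      = fun x => 1 / 2 * (exp (-(t * x ^ 2 / 2)) * exp (c * x) * sin (u * x))
        + 1 / 2 * (exp (-(t * x ^ 2 / 2)) * exp (-c * x) * sin (-u * x)) := by
    funext x
    rcases abs_choice x with h | h <;> simp [h, sinh_eq, mul_comm u x] <;> ring
  have hI (c u : ℝ) :
      Integrable fun x : ℝ => exp (-(t * x ^ 2 / 2)) * exp (c * x) * sin (u * x) := by
    have := integrable_exp_neg_sq_mul_exp (half_pos ht) c
    refine this.mono' (by fun_prop) (ae_of_all _ fun x => ?_)
    rw [norm_mul, Real.norm_of_nonneg (by positivity), Real.norm_eq_abs,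
      show t * x ^ 2 / 2 = t / 2 * x ^ 2 by ring]
    exact mul_le_of_le_one_right (by positivity) (abs_sin_le_one _)
  rw [h', integral_add ((hI c u).const_mul _) ((hI (-c) (-u)).const_mul _), integral_const_mul,
    integral_const_mul, integral_gaussian_mul_exp_mul_sin ht,
    integral_gaussian_mul_exp_mul_sin ht, neg_sq, neg_sq, neg_mul_neg] at h
  linarith

theorem abs_sinh_mul_exp_le {r : ℝ} (hr : 0 < r) (v : ℝ) :
    |exp (-(r * cosh v)) * sinh v| ≤ 2 / r * exp (-(r / 2 * cosh v)) := by
  have h1 : |sinh v| ≤ cosh v := by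
    rw [abs_le, cosh_eq, sinh_eq]
    constructor <;> linarith [exp_pos v, exp_pos (-v)]
  have h2 : r / 2 * cosh v ≤ exp (r / 2 * cosh v) := by
    linarith [add_one_le_exp (r / 2 * cosh v)]
  have h3 : exp (-(r * cosh v)) = exp (-(r / 2 * cosh v)) * exp (-(r / 2 * cosh v)) := by
    rw [← Real.exp_add]; ring_nf
  rw [abs_mul, abs_of_pos (exp_pos _), h3, exp_neg]
  have := exp_pos (r / 2 * cosh v)
  calc _ ≤ (exp (r / 2 * cosh v))⁻¹ * (exp (r / 2 * cosh v))⁻¹ * cosh v := by gcongr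
    _ = (exp (r / 2 * cosh v))⁻¹ * (2 / r * ((exp (r / 2 * cosh v))⁻¹ * (r / 2 * cosh v))) := by
        field_simp
    _ ≤ (exp (r / 2 * cosh v))⁻¹ * (2 / r * 1) := by
        gcongr
        rw [inv_mul_le_iff₀ this]; linarith
    _ = _ := by ring

theorem integrable_exp_neg_mul_cosh_mul_sinh {r : ℝ} (hr : 0 < r) :
    Integrable fun v : ℝ => exp (-(r * cosh v)) * sinh v :=
  ((integrable_exp_neg_mul_cosh (half_pos hr)).const_mul (2 / r)).mono' (by fun_prop)
    (ae_of_all _ fun v => abs_sinh_mul_exp_le hr v)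

theorem mul_besselKi_eq {r : ℝ} (hr : 0 < r) (τ : ℝ) :
    τ * besselKi τ r = r / 2 * ∫ v : ℝ, exp (-(r * cosh v)) * sinh v * sin (τ * v) := by
  have hS : Integrable fun v : ℝ => exp (-(r * cosh v)) * sinh v * sin (τ * v) := by
    refine (integrable_exp_neg_mul_cosh_mul_sinh hr).norm.mono' (by fun_prop)
      (ae_of_all _ fun v => ?_)
    rw [norm_mul]
    exact mul_le_of_le_one_right (norm_nonneg _) (abs_sin_le_one _)
  have hC := integrable_exp_neg_mul_cosh_mul_cos hr τ
  have hd (v : ℝ) : HasDerivAt (fun v => exp (-(r * cosh v)) * sin (τ * v))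
      (τ * (exp (-(r * cosh v)) * cos (τ * v))
        - r * (exp (-(r * cosh v)) * sinh v * sin (τ * v))) v := by
    have h1 : HasDerivAt (fun v => exp (-(r * cosh v))) (exp (-(r * cosh v)) * -(r * sinh v)) v :=
      (((hasDerivAt_cosh v).const_mul r).neg).exp
    have h2 : HasDerivAt (fun v => sin (τ * v)) (cos (τ * v) * (τ * 1)) v :=
      ((hasDerivAt_id v).const_mul τ).sin
    exact (h1.mul h2).congr_deriv (by ring)
  have h := integral_eq_zero_of_hasDerivAt_of_integrable hd
    ((hC.const_mul τ).sub (hS.const_mul r)) (integrable_exp_neg_mul_cosh_mul_sin hr τ)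
  rw [integral_sub (hC.const_mul τ) (hS.const_mul r), integral_const_mul, integral_const_mul] at h
  rw [besselKi_eq_half_integral]
  linarith

theorem integrable_gaussian_mul_sinh {t : ℝ} (ht : 0 < t) (c : ℝ) :
    Integrable fun τ : ℝ => exp (-(t * τ ^ 2 / 2)) * sinh (c * τ) := by
  have h1 := integrable_exp_neg_sq_mul_exp (half_pos ht) c
  have h2 := integrable_exp_neg_sq_mul_exp (half_pos ht) (-c)
  refine ((h1.sub h2).const_mul (1 / 2)).congr (ae_of_all _ fun τ => ?_)
  simp only [Pi.sub_apply, sinh_eq]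
  ring_nf

/-- The representation of the Yor integral as an index integral. -/
theorem setIntegral_mul_besselKi_eq_yorF {r t : ℝ} (hr : 0 < r) (ht : 0 < t) :
    ∫ τ in Ioi 0, exp (-(t * τ ^ 2 / 2)) * τ * sinh (π * τ) * besselKi τ r
      = π ^ 2 * r * yorF t r := by
  have hI : Integrable (Function.uncurry fun τ v : ℝ =>
      exp (-(t * τ ^ 2 / 2)) * sinh (π * τ) * (exp (-(r * cosh v)) * sinh v) * sin (τ * v))
      ((volume.restrict (Ioi 0)).prod volume) := by
    refine ((integrable_gaussian_mul_sinh ht π).restrict.norm.mul_prod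
      (integrable_exp_neg_mul_cosh_mul_sinh hr).norm).mono'
      (Continuous.aestronglyMeasurable (by unfold Function.uncurry; fun_prop))
      (ae_of_all _ fun z => ?_)
    rw [← norm_mul]
    simp only [Function.uncurry]
    rw [norm_mul _ (sin _)]
    exact mul_le_of_le_one_right (norm_nonneg _) (abs_sin_le_one _)
  have hY : ∫ v : ℝ, exp (-(r * cosh v)) * sinh v * (exp (-(v ^ 2 / (2 * t))) * sin (π * v / t))
      = 2 * ∫ y in Ioi (0 : ℝ),
        exp (-(y ^ 2 / (2 * t))) * exp (-(r * cosh y)) * sinh y * sin (π * y / t) := by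
    rw [← integral_comp_abs (f := fun y =>
      exp (-(y ^ 2 / (2 * t))) * exp (-(r * cosh y)) * sinh y * sin (π * y / t))]
    congr 1 with v
    rcases abs_choice v with h | h <;> simp [h, neg_div] <;> ring
  calc _ = ∫ τ in Ioi 0, r / 2 * ∫ v : ℝ,
          exp (-(t * τ ^ 2 / 2)) * sinh (π * τ) * (exp (-(r * cosh v)) * sinh v) * sin (τ * v) := by
        congr 1 with τ
        have := mul_besselKi_eq hr τ
        simp_rw [mul_assoc (exp (-(t * τ ^ 2 / 2)) * sinh (π * τ))]
        rw [integral_const_mul]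
        linear_combination (exp (-(t * τ ^ 2 / 2)) * sinh (π * τ)) * this
    _ = r / 2 * ∫ v : ℝ, ∫ τ in Ioi 0,
          exp (-(t * τ ^ 2 / 2)) * sinh (π * τ) * (exp (-(r * cosh v)) * sinh v) * sin (τ * v) := by
        rw [integral_const_mul, integral_integral_swap hI]
    _ = r / 2 * ∫ v : ℝ, (√(2 * π / t) / 2 * exp (π ^ 2 / (2 * t))) *
          (exp (-(r * cosh v)) * sinh v * (exp (-(v ^ 2 / (2 * t))) * sin (π * v / t))) := by
        congr 2 with v
        have h := setIntegral_gaussian_mul_sinh_mul_sin ht π v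
        calc _ = (exp (-(r * cosh v)) * sinh v) *
              ∫ τ in Ioi 0, exp (-(t * τ ^ 2 / 2)) * sinh (π * τ) * sin (τ * v) := by
              rw [← integral_const_mul]; congr 1 with τ; ring
          _ = _ := by
              rw [h, sub_div, sub_eq_add_neg, Real.exp_add]; ring
    _ = _ := by
        rw [integral_const_mul, hY, yorF]
        have h1 : √(2 * π ^ 3 * t) * √(2 * π / t) = 2 * π ^ 2 := by
          rw [← sqrt_mul (by positivity), show 2 * π ^ 3 * t * (2 * π / t) = (2 * π ^ 2) ^ 2 by
            field_simp, sqrt_sq (by positivity)]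
        have h2 : 0 < √(2 * π ^ 3 * t) := by positivity
        have h3 : √(2 * π / t) = 2 * π ^ 2 / √(2 * π ^ 3 * t) := by
          rw [eq_div_iff h2.ne']; linarith
        rw [h3]
        field_simp

theorem measurable_yorF (t : ℝ) : Measurable (yorF t) := by
  have : Measurable (Function.uncurry fun (r y : ℝ) =>
      exp (-(y ^ 2 / (2 * t))) * exp (-(r * cosh y)) * sinh y * sin (π * y / t)) := by
    unfold Function.uncurry
    apply Continuous.measurable
    fun_prop
  exact (this.stronglyMeasurable.integral_prod_right).measurable.const_mul _

theorem exists_abs_yorF_le {t : ℝ} (ht : 0 < t) : ∃ C, ∀ r, 0 < r → |yorF t r| ≤ C := by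
  have ht' : 0 < t⁻¹ := inv_pos.2 ht
  have hI := (integrable_gaussian_mul_sinh ht' 1).norm.integrableOn (s := Ioi 0)
  refine ⟨|exp (π ^ 2 / (2 * t)) / √(2 * π ^ 3 * t)| *
    ∫ y in Ioi 0, ‖exp (-(t⁻¹ * y ^ 2 / 2)) * sinh (1 * y)‖, fun r hr => ?_⟩
  rw [yorF, abs_mul]
  gcongr
  rw [← Real.norm_eq_abs]
  refine norm_integral_le_of_norm_le hI (ae_of_all _ fun y => ?_)
  rw [show t⁻¹ * y ^ 2 / 2 = y ^ 2 / (2 * t) by field_simp, one_mul]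
  simp only [norm_mul, Real.norm_eq_abs]
  have h1 : |exp (-(r * cosh y))| ≤ 1 := by
    rw [abs_of_pos (exp_pos _), exp_le_one_iff]
    have := cosh_pos y
    nlinarith
  calc _ ≤ |exp (-(y ^ 2 / (2 * t)))| * 1 * |sinh y| * 1 := by
        gcongr
        exact abs_sin_le_one _
    _ = _ := by ring

theorem integrable_gaussian_mul_mul_sinh {t : ℝ} (ht : 0 < t) (c : ℝ) :
    Integrable fun τ : ℝ => exp (-(t * τ ^ 2 / 2)) * τ * sinh (c * τ) := by
  have h (a : ℝ) := integrable_exp_neg_sq_mul_exp (half_pos ht) a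
  refine (((h (1 + c)).add (h (1 - c))).add ((h (-1 + c)).add (h (-1 - c)))).mono'
    (by fun_prop) (ae_of_all _ fun τ => ?_)
  have h1 : |τ| ≤ exp τ + exp (-τ) := by
    rw [abs_le]
    constructor <;> linarith [add_one_le_exp τ, add_one_le_exp (-τ), exp_pos τ, exp_pos (-τ)]
  have h2 : |sinh (c * τ)| ≤ exp (c * τ) + exp (-(c * τ)) := by
    rw [abs_le, sinh_eq]
    constructor <;> linarith [exp_pos (c * τ), exp_pos (-(c * τ))]
  rw [norm_mul, norm_mul, Real.norm_of_nonneg (exp_pos _).le, Real.norm_eq_abs, Real.norm_eq_abs,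
    mul_assoc]
  calc _ ≤ exp (-(t * τ ^ 2 / 2)) *
        ((exp τ + exp (-τ)) * (exp (c * τ) + exp (-(c * τ)))) := by gcongr
    _ = _ := by
        simp only [Pi.add_apply, add_mul, one_mul, neg_mul, Real.exp_add,
          sub_eq_add_neg]
        rw [show t / 2 * τ ^ 2 = t * τ ^ 2 / 2 by ring]
        ring

theorem integrable_prod_mul_besselKi {ψ γ : ℝ → ℝ} (hm : Measurable ψ)
    (hψ : IntegrableOn (fun u => ψ u * u ^ (-(1 / 2) : ℝ)) (Ioi 0))
    (hγ : IntegrableOn γ (Ioi 0)) :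
    Integrable (Function.uncurry fun u τ => ψ u * (γ τ * besselKi τ u))
      ((volume.restrict (Ioi 0)).prod (volume.restrict (Ioi 0))) := by
  set C := ∫ v : ℝ, cosh v ^ (-(1 / 2) : ℝ)
  refine ((hψ.norm.mul_prod hγ.norm).const_mul C).mono'
    ((hm.comp measurable_fst).aestronglyMeasurable.mul
      ((hγ.aestronglyMeasurable.comp_snd).mul
        (measurable_besselKi.comp measurable_swap).aestronglyMeasurable)) ?_
  rw [Measure.prod_restrict]
  refine (ae_restrict_iff' (measurableSet_Ioi.prod measurableSet_Ioi)).2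
    (ae_of_all _ fun z hz => ?_)
  have hz1 : 0 < z.1 := hz.1
  simp only [Function.uncurry, norm_mul, Real.norm_eq_abs]
  rw [abs_of_nonneg (rpow_nonneg hz1.le (-(1 / 2)))]
  calc _ ≤ |ψ z.1| * (|γ z.2| * (C * z.1 ^ (-(1 / 2) : ℝ))) := by
        gcongr; exact abs_besselKi_le _ hz1
    _ = _ := by ring

theorem integrableOn_mul_integral_besselKi {ψ γ : ℝ → ℝ} (hm : Measurable ψ)
    (hψ : IntegrableOn (fun u => ψ u * u ^ (-(1 / 2) : ℝ)) (Ioi 0))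
    (hγ : IntegrableOn γ (Ioi 0)) :
    IntegrableOn (fun u => ψ u * ∫ τ in Ioi 0, γ τ * besselKi τ u) (Ioi 0) := by
  have h := (integrable_prod_mul_besselKi hm hψ hγ).integral_prod_left
  refine h.congr (ae_of_all _ fun u => ?_)
  simp only [Function.uncurry]
  rw [integral_const_mul]

theorem setIntegral_mul_integral_besselKi {ψ γ : ℝ → ℝ} (hm : Measurable ψ)
    (hψ : IntegrableOn (fun u => ψ u * u ^ (-(1 / 2) : ℝ)) (Ioi 0))
    (hγ : IntegrableOn γ (Ioi 0)) :
    ∫ u in Ioi 0, ψ u * ∫ τ in Ioi 0, γ τ * besselKi τ u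
      = ∫ τ in Ioi 0, γ τ * ∫ u in Ioi 0, ψ u * besselKi τ u := by
  calc _ = ∫ u in Ioi 0, ∫ τ in Ioi 0, ψ u * (γ τ * besselKi τ u) := by
        simp_rw [integral_const_mul]
    _ = ∫ τ in Ioi 0, ∫ u in Ioi 0, ψ u * (γ τ * besselKi τ u) :=
        integral_integral_swap (integrable_prod_mul_besselKi hm hψ hγ)
    _ = _ := by
        congr 1 with τ
        rw [← integral_const_mul]
        congr 1 with u
        ring

theorem integrableOn_heat_weight {t r : ℝ} (ht : 0 < t) (hr : 0 < r) :
    IntegrableOn (fun τ => exp (-(t * τ ^ 2 / 2)) * τ * sinh (π * τ) * besselKi τ r) (Ioi 0) := by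
  refine ((integrable_gaussian_mul_mul_sinh ht π).norm.const_mul
    ((∫ v : ℝ, cosh v ^ (-(1 / 2) : ℝ)) * r ^ (-(1 / 2) : ℝ))).restrict.mono'
    ((Continuous.aestronglyMeasurable (by fun_prop)).mul
      (measurable_besselKi.comp (measurable_id.prodMk measurable_const)).aestronglyMeasurable)
    (ae_of_all _ fun τ => ?_)
  rw [norm_mul, mul_comm]
  gcongr
  exact abs_besselKi_le τ hr

theorem klHeat_mul_eq (k : ℕ) (r t : ℝ) {u : ℝ} (hu : 0 < u) :
    exp (-u) * klHeat t r u * klPoly (k + 1) u / u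
      = 2 / (r * π ^ 2) * ((klCofactor k).eval u * exp (-u) *
        ∫ τ in Ioi 0, exp (-(t * τ ^ 2 / 2)) * τ * sinh (π * τ) * besselKi τ r * besselKi τ u) := by
  rw [klHeat, klPoly_succ]
  field_simp

theorem integrableOn_yorCoeff (k : ℕ) {r t : ℝ} (hr : 0 < r) (ht : 0 < t) :
    IntegrableOn (fun u => exp (-u) * klHeat t r u * klPoly (k + 1) u / u) (Ioi 0) :=
  ((integrableOn_mul_integral_besselKi (measurable_eval_mul_exp_neg (klCofactor k))
    (integrableOn_eval_mul_exp_neg_mul_rpow _) (integrableOn_heat_weight ht hr)).const_mul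
    (2 / (r * π ^ 2))).congr
    ((ae_restrict_iff' measurableSet_Ioi).2 (ae_of_all _ fun _ hu => (klHeat_mul_eq k r t hu).symm))

theorem yorCoeff_succ (k : ℕ) {r t : ℝ} (hr : 0 < r) (ht : 0 < t) :
    yorCoeff (k + 1) r t = 2 / (r * π ^ 2) * ∫ τ in Ioi 0,
      (-1) ^ (k + 1) * π * (exp (-(t * τ ^ 2 / 2)) * besselKi τ r * τ ^ (2 * k + 2)) := by
  rw [yorCoeff, setIntegral_congr_fun measurableSet_Ioi fun u hu => klHeat_mul_eq k r t hu,
    integral_const_mul, setIntegral_mul_integral_besselKi (measurable_eval_mul_exp_neg _)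
    (integrableOn_eval_mul_exp_neg_mul_rpow _) (integrableOn_heat_weight ht hr)]
  congr 1
  refine setIntegral_congr_fun measurableSet_Ioi fun τ (hτ : 0 < τ) => ?_
  have h := besselKiMoment_klCofactor hτ k
  rw [besselKiMoment] at h
  have hs : 0 < sinh (π * τ) := sinh_pos_iff.2 (by positivity)
  simp only [h]
  field_simp
  ring

theorem hasSum_yorCoeff {r t : ℝ} (hr : 0 < r) (ht : 0 < t) :
    HasSum (fun j : ℕ => (-1 : ℝ) ^ (j + 1) * π ^ (2 * j) * yorCoeff (j + 1) r t /
        ((2 * j + 1).factorial : ℝ)) (2 * yorF t r) := by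
  set C := (∫ v : ℝ, cosh v ^ (-(1 / 2) : ℝ)) * r ^ (-(1 / 2) : ℝ)
  have hsinh (τ a : ℝ) : HasSum (fun j : ℕ =>
      a * ((π * τ) ^ (2 * j + 1) / ((2 * j + 1).factorial : ℝ))) (a * sinh (π * τ)) :=
    (Real.hasSum_sinh (π * τ)).mul_left a
  have hm : Measurable fun τ => besselKi τ r :=
    measurable_besselKi.comp (measurable_id.prodMk measurable_const)
  have h := hasSum_integral_of_dominated_convergence (μ := volume.restrict (Ioi (0 : ℝ)))
    (F := fun (j : ℕ) τ => exp (-(t * τ ^ 2 / 2)) * besselKi τ r * τ *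
      ((π * τ) ^ (2 * j + 1) / ((2 * j + 1).factorial : ℝ)))
    (f := fun τ => exp (-(t * τ ^ 2 / 2)) * besselKi τ r * τ * sinh (π * τ))
    (fun (j : ℕ) τ => exp (-(t * τ ^ 2 / 2)) * C * τ *
      ((π * τ) ^ (2 * j + 1) / ((2 * j + 1).factorial : ℝ)))
    (fun j => by
      refine Measurable.aestronglyMeasurable ?_
      fun_prop)
    (fun j => (ae_restrict_iff' measurableSet_Ioi).2 (ae_of_all _ fun τ (hτ : 0 < τ) => by
      have h0 : 0 ≤ (π * τ) ^ (2 * j + 1) / ((2 * j + 1).factorial : ℝ) := by positivity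
      rw [norm_mul, norm_mul, norm_mul, Real.norm_of_nonneg h0, Real.norm_of_nonneg hτ.le,
        Real.norm_of_nonneg (exp_pos _).le]
      gcongr
      exact abs_besselKi_le τ hr))
    (ae_of_all _ fun τ => (hsinh τ _).summable)
    (by
      simp_rw [(hsinh _ _).tsum_eq]
      refine ((integrable_gaussian_mul_mul_sinh ht π).const_mul C).restrict.congr
        (ae_of_all _ fun τ => ?_)
      ring)
    (ae_of_all _ fun τ => hsinh τ _)
  have hF : ∫ τ in Ioi 0, exp (-(t * τ ^ 2 / 2)) * besselKi τ r * τ * sinh (π * τ)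
      = π ^ 2 * r * yorF t r := by
    rw [← setIntegral_mul_besselKi_eq_yorF hr ht]
    congr 1 with τ
    ring
  rw [hF] at h
  have h' := h.mul_left (2 / (r * π ^ 2))
  rw [show 2 / (r * π ^ 2) * (π ^ 2 * r * yorF t r) = 2 * yorF t r by field_simp] at h'
  refine (congrArg (HasSum · (2 * yorF t r)) (funext fun j => ?_)).mpr h'
  rw [yorCoeff_succ j hr ht, integral_const_mul]
  have e : ∫ τ in Ioi 0, exp (-(t * τ ^ 2 / 2)) * besselKi τ r * τ *
      ((π * τ) ^ (2 * j + 1) / ((2 * j + 1).factorial : ℝ))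
      = π ^ (2 * j + 1) / ((2 * j + 1).factorial : ℝ) *
        ∫ τ in Ioi 0, exp (-(t * τ ^ 2 / 2)) * besselKi τ r * τ ^ (2 * j + 2) := by
    rw [← integral_const_mul]
    congr 1 with τ
    ring
  rw [e]
  have h1 : ((-1 : ℝ) ^ (j + 1)) * (-1) ^ (j + 1) = 1 := by rw [← mul_pow]; simp
  linear_combination (π ^ (2 * j) * (2 / (r * π ^ 2)) * π / ((2 * j + 1).factorial : ℝ) *
    ∫ τ in Ioi 0, exp (-(t * τ ^ 2 / 2)) * besselKi τ r * τ ^ (2 * j + 2)) * h1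

theorem klKernel_mul_exp_neg_le {x u y : ℝ} (hx : 0 < x) (hu : 0 < u) (hy : 0 < y) :
    klKernel x u y * exp (-u) ≤ exp (-(1 / 2 * u)) * exp (-√x * y ^ (1 / 2 : ℝ)) := by
  rw [klKernel, ← Real.exp_add, ← Real.exp_add, ← sqrt_eq_rpow]
  apply exp_le_exp.2
  have h1 : x * ((u ^ 2 + y ^ 2) / (u * y)) + y * u / x = x * u / y + y * u / x + x * y / u := by
    field_simp
    ring
  have h2 : 0 < x * u / y + y * u / x := by positivity
  have h3 : 2 * √x * √y - u ≤ x * y / u := by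
    rw [le_div_iff₀ hu]
    nlinarith [sq_nonneg (√x * √y - u), sq_sqrt hx.le, sq_sqrt hy.le,
      mul_pow (√x) (√y) 2]
  rw [h1]
  linarith

theorem integrableOn_klConvIntegrand (k : ℕ) {r t : ℝ} (hr : 0 < r) (ht : 0 < t) :
    IntegrableOn (klConvIntegrand (klWeight (k + 1)) (yorF t) r) (Ioi 0 ×ˢ Ioi 0) := by
  obtain ⟨C, hC⟩ := exists_abs_yorF_le ht
  have hQ : IntegrableOn (fun u : ℝ => (klCofactor k).eval u * exp (-(1 / 2 * u))) (Ioi 0) := by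
    simpa using integrableOn_eval_mul_exp_neg_mul_mul_rpow (klCofactor k) (b := 1 / 2)
      (s := 0) (by norm_num) (by norm_num)
  have hE : IntegrableOn (fun y : ℝ => exp (-√r * y ^ (1 / 2 : ℝ))) (Ioi 0) := by
    simpa using integrableOn_rpow_mul_exp_neg_mul_rpow (p := 1 / 2) (s := 0) (b := √r)
      (by norm_num) (by norm_num) (sqrt_pos.2 hr)
  have hmeas : Measurable fun z : ℝ × ℝ =>
      klKernel r z.1 z.2 * (exp (-z.1) * (klCofactor k).eval z.1) * yorF t z.2 := by
    refine ((measurable_klKernel r).mul ?_).mul ((measurable_yorF t).comp measurable_snd)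
    exact (Continuous.mul (by fun_prop) ((klCofactor k).continuous.comp continuous_fst)).measurable
  have hdom := (hQ.norm.mul_prod hE).const_mul C
  rw [Measure.prod_restrict] at hdom
  have hint : IntegrableOn (fun z : ℝ × ℝ =>
      klKernel r z.1 z.2 * (exp (-z.1) * (klCofactor k).eval z.1) * yorF t z.2)
      (Ioi 0 ×ˢ Ioi 0) := by
    refine Integrable.mono' hdom hmeas.aestronglyMeasurable
      ((ae_restrict_iff' (measurableSet_Ioi.prod measurableSet_Ioi)).2
        (ae_of_all _ fun z hz => ?_))
    have hz1 : 0 < z.1 := hz.1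
    have hz2 : 0 < z.2 := hz.2
    have hC0 : 0 ≤ C := (abs_nonneg _).trans (hC _ hz2)
    have hk : 0 ≤ klKernel r z.1 z.2 := (exp_pos _).le
    simp only [norm_mul]
    rw [Real.norm_of_nonneg hk, Real.norm_of_nonneg (exp_pos (-z.1)).le,
      Real.norm_of_nonneg (exp_pos (-(1 / 2 * z.1))).le]
    calc _ = klKernel r z.1 z.2 * exp (-z.1) * ‖(klCofactor k).eval z.1‖ * ‖yorF t z.2‖ := by ring
      _ ≤ exp (-(1 / 2 * z.1)) * exp (-√r * z.2 ^ (1 / 2 : ℝ)) *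
          ‖(klCofactor k).eval z.1‖ * C := by
          exact mul_le_mul (mul_le_mul_of_nonneg_right (klKernel_mul_exp_neg_le hr hz1 hz2)
            (norm_nonneg _)) (hC _ hz2) (norm_nonneg _) (by positivity)
      _ = _ := by ring
  refine hint.congr_fun (fun z hz => ?_) (measurableSet_Ioi.prod measurableSet_Ioi)
  simp only [klConvIntegrand, klKernel]
  rw [klWeight_succ k hz.1]

theorem setIntegral_klKernel_mul_yorF {r t u : ℝ} (hr : 0 < r) (ht : 0 < t) (hu : 0 < u) :
    ∫ y in Ioi 0, klKernel r u y * yorF t y = r * klHeat t r u := by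
  have h1 : ∀ y ∈ Ioi (0 : ℝ), klKernel r u y * yorF t y = (π ^ 2)⁻¹ * (klKernel r u y / y *
      ∫ τ in Ioi 0, exp (-(t * τ ^ 2 / 2)) * τ * sinh (π * τ) * besselKi τ y) := by
    intro y (hy : 0 < y)
    rw [setIntegral_mul_besselKi_eq_yorF hy ht]
    field_simp
  rw [setIntegral_congr_fun measurableSet_Ioi h1, integral_const_mul,
    setIntegral_mul_integral_besselKi (measurable_klKernel_div r u) (integrableOn_klKernel_div hr hu)
      (integrable_gaussian_mul_mul_sinh ht π).integrableOn, klHeat]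
  simp_rw [setIntegral_klKernel_div_mul_besselKi hr hu]
  have h2 : ∫ τ in Ioi 0, exp (-(t * τ ^ 2 / 2)) * τ * sinh (π * τ) *
      (2 * besselKi τ r * besselKi τ u) = 2 * ∫ τ in Ioi 0,
        exp (-(t * τ ^ 2 / 2)) * τ * sinh (π * τ) * besselKi τ r * besselKi τ u := by
    rw [← integral_const_mul]
    congr 1 with τ
    ring
  rw [h2]
  field_simp

theorem klConv_klWeight_yorF (k : ℕ) {r t : ℝ} (hr : 0 < r) (ht : 0 < t) :
    klConv (klWeight (k + 1)) (yorF t) r = yorCoeff (k + 1) r t / 2 := by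
  have h := setIntegral_prod _ (integrableOn_klConvIntegrand k hr ht)
  rw [klConv, Measure.volume_eq_prod, h, yorCoeff]
  have h1 : ∀ u ∈ Ioi (0 : ℝ),
      ∫ y in Ioi 0, klConvIntegrand (klWeight (k + 1)) (yorF t) r (u, y)
        = r * (exp (-u) * klHeat t r u * klPoly (k + 1) u / u) := by
    intro u hu
    calc _ = ∫ y in Ioi 0, klWeight (k + 1) u * (klKernel r u y * yorF t y) := by
          congr 1 with y
          rw [klConvIntegrand, klKernel]; ring
      _ = _ := by
          rw [integral_const_mul, setIntegral_klKernel_mul_yorF hr ht hu, klWeight]; ring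
  rw [setIntegral_congr_fun measurableSet_Ioi h1, integral_const_mul]
  field_simp

theorem theorem4 (r t : ℝ) (hr : 0 < r) (ht : 0 < t) :
    -- all the convolutions and all the coefficients are absolutely convergent integrals
    (∀ k : ℕ, 1 ≤ k →
      IntegrableOn (klConvIntegrand (klWeight k) (yorF t) r) (Ioi (0 : ℝ) ×ˢ Ioi (0 : ℝ)) ∧
      IntegrableOn (fun u : ℝ => exp (-u) * klHeat t r u * klPoly k u / u) (Ioi (0 : ℝ))) ∧
    -- the two series, with summation index `j = k - 1`
    HasSum (fun j : ℕ => (-1 : ℝ) ^ (j + 1) * π ^ (2 * j) / ((2 * j + 1).factorial : ℝ) *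
        klConv (klWeight (j + 1)) (yorF t) r)
      (yorF t r) ∧
    HasSum (fun j : ℕ => (-1 : ℝ) ^ (j + 1) * π ^ (2 * j) * yorCoeff (j + 1) r t /
        ((2 * j + 1).factorial : ℝ))
      (2 * yorF t r) := by
  refine ⟨fun k hk => ?_, ?_, hasSum_yorCoeff hr ht⟩
  · obtain ⟨k, rfl⟩ := Nat.exists_eq_add_of_le' hk
    exact ⟨integrableOn_klConvIntegrand k hr ht, integrableOn_yorCoeff k hr ht⟩
  · have h := (hasSum_yorCoeff hr ht).mul_left (1 / 2)
    rw [show 1 / 2 * (2 * yorF t r) = yorF t r by ring] at h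
    refine (congrArg (HasSum · (yorF t r)) (funext fun j => ?_)).mpr h
    rw [klConv_klWeight_yorF j hr ht]; ring
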